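/- Let $n\ge 0$ and let $W$ be a Coxeter group of type $A_n$ or of type $B_n$ (equivalently, up to isomorphism, the symmetric group $S_{n+1}$ or the hyperoctahedral group of signed permutations of $\{\pm1,\dots,\pm n\}$). Let $T\subset W$ be its set of reflections, i.e. of all conjugates of the simple generators, let $l_T(w)$ be the smallest $k$ such that $w$ is a product of $k$ elements of $T$, and let the absolute order on $W$ be the partial order in which $x\le y$ if and only if $l_T(y)=l_T(x)+l_T(x^{-1}y)$. It is graded with rank function $l_T$. Then the absolute order on $W$ is strong Sperner. That is: $W$ is finite and, writing $W_i=\{w\in W : l_T(w)=i\}$ and $r=\max_{w\in W} l_T(w)$, for every $k$ with $1\le k\le r+1$ the union of the $k$ largest of the rank levels $W_0,\dots,W_r$ (with ties broken in any way) is a $k$-family of maximal size, where a $k$-family is a subset of $W$ that contains no chain of size $k+1$. -/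

import Mathlib

/-! ### The Sperner property in graded posets -/

section Sperner

variable (P : Type*) [PartialOrder P] [GradeMinOrder ℕ P]

/-- The rank level `P_i` of a graded poset, i.e. the set of its elements of rank `i`. -/
def rankLevel (i : ℕ) : Set P := {x | grade ℕ x = i}

/-- The rank `r` of a finite nonempty graded poset: the largest rank of an element. -/
noncomputable def posetRank : ℕ := sSup (Set.range fun x : P => grade ℕ x)

variable {P} in
/-- A `k`-family: a subset that contains no chain of size `k + 1`. -/
def IsKFamily (k : ℕ) (F : Set P) : Prop :=
  ¬ ∃ C : Finset P, (C : Set P) ⊆ F ∧ IsChain (· ≤ ·) (C : Set P) ∧ C.card = k + 1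

/-- The levels `P_i`, `i ∈ I`, are `k` largest ones among `P_0, …, P_r`. If several levels have
the same size, there may be several such `I`. -/
def AreLargestLevels (k : ℕ) (I : Finset ℕ) : Prop :=
  I ⊆ Finset.range (posetRank P + 1) ∧ I.card = k ∧
    ∀ i ∈ I, ∀ j ∈ Finset.range (posetRank P + 1), j ∉ I →
      (rankLevel P j).ncard ≤ (rankLevel P i).ncard

/-- `k`-Sperner, for finite graded posets: the union of the `k` largest rank levels (for every
way of breaking ties) is a `k`-family of maximal size. -/
def IsKSperner (k : ℕ) : Prop :=
  ∀ I : Finset ℕ, AreLargestLevels P k I →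
    IsKFamily k (⋃ i ∈ I, rankLevel P i) ∧
      ∀ F : Set P, IsKFamily k F → F.ncard ≤ (⋃ i ∈ I, rankLevel P i).ncard

/-- A graded poset is strong Sperner if it is finite and `k`-Sperner for all `k ∈ [1, r + 1]`. -/
def IsStrongSperner : Prop :=
  Finite P ∧ ∀ k : ℕ, 1 ≤ k → k ≤ posetRank P + 1 → IsKSperner P k

end Sperner

/-! ### The absolute order of a Coxeter group -/

section Absolute

variable {B W : Type*} [Group W] {M : CoxeterMatrix B} (cs : CoxeterSystem M W)

/-- The absolute length `l_T`: the smallest length of a word in the set `T` of all reflections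
(conjugates of simple reflections) that represents `w`. -/
noncomputable def absLength (w : W) : ℕ :=
  sInf {k | ∃ l : List W, l.length = k ∧ (∀ t ∈ l, cs.IsReflection t) ∧ l.prod = w}

theorem absLength_exists (w : W) :
    ∃ l : List W, l.length = absLength cs w ∧ (∀ t ∈ l, cs.IsReflection t) ∧ l.prod = w := by
  refine Nat.sInf_mem
    (s := {k | ∃ l : List W, l.length = k ∧ (∀ t ∈ l, cs.IsReflection t) ∧ l.prod = w}) ?_
  obtain ⟨ω, rfl⟩ := cs.wordProd_surjective w
  refine ⟨_, ω.map cs.simple, rfl, ?_, rfl⟩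
  intro t ht
  obtain ⟨i, -, rfl⟩ := List.mem_map.1 ht
  exact cs.isReflection_simple i

theorem absLength_le {l : List W} (hl : ∀ t ∈ l, cs.IsReflection t) :
    absLength cs l.prod ≤ l.length :=
  Nat.sInf_le ⟨l, rfl, hl, rfl⟩

theorem absLength_one : absLength cs 1 = 0 := by
  have h := absLength_le cs (l := []) (by simp)
  simpa using h

theorem absLength_eq_zero {w : W} (h : absLength cs w = 0) : w = 1 := by
  obtain ⟨l, hl, -, rfl⟩ := absLength_exists cs w
  rw [h, List.length_eq_zero_iff] at hl
  simp [hl]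

theorem absLength_mul_le (x y : W) :
    absLength cs (x * y) ≤ absLength cs x + absLength cs y := by
  obtain ⟨l, hl, hlr, hlx⟩ := absLength_exists cs x
  obtain ⟨m, hm, hmr, hmy⟩ := absLength_exists cs y
  have h := absLength_le cs (l := l ++ m) (by
    intro t ht
    rcases List.mem_append.1 ht with ht | ht
    · exact hlr t ht
    · exact hmr t ht)
  rw [List.prod_append, hlx, hmy, List.length_append, hl, hm] at h
  exact h

theorem absLength_le_add (x y : W) :
    absLength cs y ≤ absLength cs x + absLength cs (x⁻¹ * y) := by
  simpa using absLength_mul_le cs x (x⁻¹ * y)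

/-- The underlying set of the absolute order on `W`: a copy of `W`, which carries the order below. -/
def AbsoluteOrder (_cs : CoxeterSystem M W) : Type _ := W

/-- The absolute order: `x ≤ y` if and only if `l_T(y) = l_T(x) + l_T(x⁻¹ y)`. -/
instance : PartialOrder (AbsoluteOrder cs) where
  le := fun x y : W => absLength cs y = absLength cs x + absLength cs (x⁻¹ * y)
  le_refl := fun x : W => by
    show absLength cs x = absLength cs x + absLength cs (x⁻¹ * x)
    simp [absLength_one]
  le_trans := fun (x y z : W)
      (hxy : absLength cs y = absLength cs x + absLength cs (x⁻¹ * y))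
      (hyz : absLength cs z = absLength cs y + absLength cs (y⁻¹ * z)) => by
    show absLength cs z = absLength cs x + absLength cs (x⁻¹ * z)
    have h1 := absLength_mul_le cs (x⁻¹ * y) (y⁻¹ * z)
    have h2 := absLength_le_add cs x z
    rw [mul_assoc, mul_inv_cancel_left] at h1
    omega
  le_antisymm := fun (x y : W)
      (hxy : absLength cs y = absLength cs x + absLength cs (x⁻¹ * y))
      (hyx : absLength cs x = absLength cs y + absLength cs (y⁻¹ * x)) => by
    have h := absLength_eq_zero cs (w := x⁻¹ * y) (by omega)
    show x = y
    exact inv_mul_eq_one.1 h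

/-- An element of `W`, seen in the absolute order. -/
def AbsoluteOrder.of (w : W) : AbsoluteOrder cs := w

theorem absoluteOrder_le_iff (x y : W) :
    AbsoluteOrder.of cs x ≤ AbsoluteOrder.of cs y ↔
      absLength cs y = absLength cs x + absLength cs (x⁻¹ * y) :=
  Iff.rfl

theorem absLength_lt {x y : W} (hxy : AbsoluteOrder.of cs x < AbsoluteOrder.of cs y) :
    absLength cs x < absLength cs y := by
  have h := (absoluteOrder_le_iff cs x y).1 hxy.le
  have h0 : absLength cs (x⁻¹ * y) ≠ 0 := fun h0 =>
    hxy.ne (congrArg (AbsoluteOrder.of cs) (inv_mul_eq_one.1 (absLength_eq_zero cs h0)))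
  omega

theorem absLength_covBy {x y : W} (hxy : AbsoluteOrder.of cs x ⋖ AbsoluteOrder.of cs y) :
    absLength cs y = absLength cs x + 1 := by
  have hle := (absoluteOrder_le_iff cs x y).1 hxy.le
  have hlt := absLength_lt cs hxy.lt
  obtain ⟨l, hl, hlr, hlp⟩ := absLength_exists cs (x⁻¹ * y)
  cases l with
  | nil =>
    simp only [List.length_nil] at hl
    omega
  | cons t l =>
    have htr : absLength cs t ≤ 1 := by
      have h := absLength_le cs (l := [t]) (by simpa using hlr t List.mem_cons_self)
      simpa using h
    have hrest : absLength cs l.prod ≤ l.length :=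
      absLength_le cs fun u hu => hlr u (List.mem_cons_of_mem _ hu)
    have heq : (x * t)⁻¹ * y = l.prod := by
      rw [List.prod_cons] at hlp
      rw [mul_inv_rev, mul_assoc, ← hlp, inv_mul_cancel_left]
    have h1 := absLength_mul_le cs x t
    have h2 := absLength_le_add cs (x * t) y
    rw [heq] at h2
    simp only [List.length_cons] at hl
    have hz1 : AbsoluteOrder.of cs x < AbsoluteOrder.of cs (x * t) := by
      refine lt_of_le_of_ne ((absoluteOrder_le_iff cs x (x * t)).2 ?_) ?_
      · rw [inv_mul_cancel_left]
        omega
      · intro h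
        have h' : absLength cs x = absLength cs (x * t) := congrArg (absLength cs) h
        omega
    have hz2 : AbsoluteOrder.of cs (x * t) ≤ AbsoluteOrder.of cs y := by
      refine (absoluteOrder_le_iff cs (x * t) y).2 ?_
      rw [heq]
      omega
    have h' : absLength cs (x * t) = absLength cs y :=
      congrArg (absLength cs) (hz2.eq_of_not_lt (hxy.2 hz1))
    omega

/-- The absolute order is graded, with rank function `l_T`. -/
noncomputable instance : GradeMinOrder ℕ (AbsoluteOrder cs) where
  grade := fun x : W => absLength cs x
  grade_strictMono := fun (x y : W) hxy => absLength_lt cs (x := x) (y := y) hxy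
  covBy_grade := fun {x y : W} hxy =>
    Nat.covBy_iff_add_one_eq.2 (absLength_covBy cs (x := x) (y := y) hxy).symm
  isMin_grade := fun {x : W} hx => by
    have h1 : AbsoluteOrder.of cs 1 ≤ AbsoluteOrder.of cs x := by
      refine (absoluteOrder_le_iff cs 1 x).2 ?_
      rw [absLength_one, inv_one, one_mul, zero_add]
    have h2 := (absoluteOrder_le_iff cs x 1).1 (hx h1)
    rw [absLength_one] at h2
    have h0 : absLength cs x = 0 := by omega
    show IsMin (absLength cs x)
    rw [h0]
    exact isMin_bot

end Absolute

/-!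
The proof builds the absolute order from claws, where a claw is a bottom element covered by
pairwise incomparable ones.

Both types are treated at once, as groups with generators `r_0, …, r_{N-1}` that satisfy the
relations of type `B_N` and act on coordinates by signed permutations: `r_0` changes the sign of the
coordinate `0` and `r_{i+1}` interchanges the coordinates `i` and `i + 1`. In type `A_{N-1}` the
generator `r_0` is trivial. Let `W_k = ⟨r_i : i < k⟩`. The left cosets of `W_k` in `W_{k+1}` are
represented by a set consisting of `1` and of reflections (`IsTypeB.exists_cosetReps_mul`, from the
relations only), and different representatives represent different cosets because they move the last
basis vector to different vectors (`IsSignedRepresentation.cosetReps_injOn`). If `c ≠ 1` is a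
representative and `h ∈ W_k`, then `l_T(c h) = l_T(h) + 1`: the rank of `ρ w - 1` bounds `l_T(w)`
from below (`rank_sub_one_le_absLength`), and it increases when `c` is multiplied to `h`
(`IsSignedRepresentation.rank_sub_one_add_one_le`). Hence `W_{k+1}` is a disjoint union of copies
`c W_k`; left multiplication by `c` preserves the absolute order on `W_k`, and `h ≤ c h`. So, up to
additional relations, the absolute order on `W_{k+1}` is the product of that on `W_k` with a claw.

Such products preserve the normalized matching property together with log-concavity of the level
sizes (`IsNormalizedLogConcave.claw`). The property is used in its dual form, that averages of
monotone functions over levels are nondecreasing, for which the inductive step is a short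
computation with averages (`claw_average_le`). Applied to the function which sends `x` to the length of the
longest chain in a `k`-family `F` below `x`, it yields the LYM inequality `∑ |F ∩ P_i| / |P_i| ≤ k`
(`lym_of_isKFamily`), and this implies the strong Sperner property.
-/

open scoped Pointwise

/-! ### Level averages of monotone functions -/

section LevelSums

variable {α : Type*}

/-- The sum of `h` over the elements of `X` of rank `i`. Ranks are taken in `ℤ`, so that the level
below the bottom one is simply empty. -/
noncomputable def levelSum (rk : α → ℕ) (X : Finset α) (h : α → ℝ) (i : ℤ) : ℝ :=
  ∑ x ∈ X, if (rk x : ℤ) = i then h x else 0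

/-- The number of elements of `X` of rank `i`, as a real number. -/
noncomputable def levelSize (rk : α → ℕ) (X : Finset α) (i : ℤ) : ℝ :=
  levelSum rk X (fun _ => 1) i

/-- `X` has the normalized matching property for the relation `le`, in its dual form: the average
over a level of a `le`-monotone function is nondecreasing in the rank. Denominators are cleared, so
that empty levels need no special treatment. Moreover its level sizes form a totally positive
sequence of order two, i.e. they are log-concave without internal zeros. -/
structure IsNormalizedLogConcave (le : α → α → Prop) (rk : α → ℕ) (X : Finset α) : Prop where
  average_mono : ∀ h : α → ℝ, (∀ x ∈ X, ∀ y ∈ X, le x y → h x ≤ h y) → ∀ i : ℤ,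
    levelSize rk X (i + 1) * levelSum rk X h i ≤ levelSize rk X i * levelSum rk X h (i + 1)
  logConcave : ∀ a b : ℤ, a ≤ b →
    levelSize rk X a * levelSize rk X (b + 1) ≤ levelSize rk X (a + 1) * levelSize rk X b

variable {rk : α → ℕ} {X : Finset α}

theorem levelSum_mono {g h : α → ℝ} {i : ℤ}
    (H : ∀ x ∈ X, (rk x : ℤ) = i → g x ≤ h x) : levelSum rk X g i ≤ levelSum rk X h i := by
  refine Finset.sum_le_sum fun x hx => ?_
  split_ifs with hi
  · exact H x hx hi
  · exact le_rfl

theorem levelSum_congr {g h : α → ℝ} {i : ℤ}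
    (H : ∀ x ∈ X, (rk x : ℤ) = i → g x = h x) : levelSum rk X g i = levelSum rk X h i :=
  le_antisymm (levelSum_mono fun x hx hi => (H x hx hi).le)
    (levelSum_mono fun x hx hi => (H x hx hi).ge)

theorem levelSum_nonneg {h : α → ℝ} {i : ℤ} (H : ∀ x ∈ X, (rk x : ℤ) = i → 0 ≤ h x) :
    0 ≤ levelSum rk X h i :=
  Finset.sum_nonneg fun x hx => by
    split_ifs with hi
    · exact H x hx hi
    · exact le_rfl

theorem levelSize_nonneg (i : ℤ) : 0 ≤ levelSize rk X i :=
  levelSum_nonneg fun _ _ _ => zero_le_one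

theorem levelSize_pos {x : α} (hx : x ∈ X) : 0 < levelSize rk X (rk x) :=
  Finset.sum_pos' (fun y _ => by split_ifs <;> norm_num) ⟨x, hx, by simp⟩

theorem levelSum_sub (g h : α → ℝ) (i : ℤ) :
    levelSum rk X (fun x => g x - h x) i = levelSum rk X g i - levelSum rk X h i := by
  simp only [levelSum, ← Finset.sum_sub_distrib]
  refine Finset.sum_congr rfl fun x _ => ?_
  split_ifs <;> simp

theorem levelSum_eq_zero {i : ℤ} (hi : levelSize rk X i = 0) (h : α → ℝ) :
    levelSum rk X h i = 0 :=
  Finset.sum_eq_zero fun x hx => by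
    split_ifs with hxi
    · exact absurd hi (hxi ▸ (levelSize_pos hx).ne')
    · rfl

/-- The numerical core of the product theorem for normalized log-concave posets. Here `n₀, n₁, n₂`
are consecutive level sizes of the base, `s` and `t` are level sums over the base and over the `m`
copies of it, which sit one level higher. -/
theorem claw_average_le {m n₀ n₁ n₂ s₁ s₂ t₀ t₁ : ℝ} (hm : 0 ≤ m) (h₀ : 0 ≤ n₀) (h₁ : 0 ≤ n₁)
    (hs : n₂ * s₁ ≤ n₁ * s₂) (ht : n₁ * t₀ ≤ n₀ * t₁)
    (hst : m * s₁ ≤ t₁) (hlc : n₀ * n₂ ≤ n₁ * n₁)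
    (z₀ : n₀ = 0 → t₀ = 0) (z₁ : n₁ = 0 → s₁ = 0 ∧ t₁ = 0) (z₂ : n₂ = 0 → s₂ = 0)
    (h₂ : 0 ≤ n₂) :
    (n₂ + m * n₁) * (s₁ + t₀) ≤ (n₁ + m * n₀) * (s₂ + t₁) := by
  suffices H : n₂ * t₀ + m * n₁ * s₁ ≤ n₁ * t₁ + m * n₀ * s₂ by
    nlinarith [mul_le_mul_of_nonneg_left ht hm]
  rcases h₁.eq_or_lt with h1 | h1
  · obtain ⟨hs1, ht1⟩ := z₁ h1.symm
    have h02 : n₀ * n₂ = 0 := le_antisymm (by rw [← h1] at hlc; simpa using hlc) (mul_nonneg h₀ h₂)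
    rcases mul_eq_zero.1 h02 with h | h
    · simp [z₀ h, hs1, ht1, h]
    · simp [z₂ h, hs1, ht1, h]
  · refine le_of_mul_le_mul_left ?_ h1
    have e1 := mul_le_mul_of_nonneg_left ht h₂
    have e2 := mul_le_mul_of_nonneg_left hs (mul_nonneg hm h₀)
    have e3 := mul_nonneg (sub_nonneg.2 hlc) (sub_nonneg.2 hst)
    nlinarith

/-- The product of a normalized log-concave poset with a claw (a bottom element covered by `m`
pairwise incomparable ones) is normalized and log-concave. The maps `f i` are the embeddings of
the copies of `X` that lie over the leaves; extra relations in `Y` do no harm. -/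
theorem IsNormalizedLogConcave.claw {ι : Type*} {le : α → α → Prop} {Y : Finset α} (s : Finset ι)
    (f : ι → α → α) (hX : IsNormalizedLogConcave le rk X)
    (hsum : ∀ F : α → ℝ, ∑ y ∈ Y, F y = ∑ x ∈ X, F x + ∑ i ∈ s, ∑ x ∈ X, F (f i x))
    (hsub : X ⊆ Y) (hmem : ∀ i ∈ s, ∀ x ∈ X, f i x ∈ Y)
    (hrk : ∀ i ∈ s, ∀ x ∈ X, rk (f i x) = rk x + 1)
    (hle : ∀ i ∈ s, ∀ x ∈ X, le x (f i x))
    (hmono : ∀ i ∈ s, ∀ x ∈ X, ∀ y ∈ X, le x y → le (f i x) (f i y)) :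
    IsNormalizedLogConcave le rk Y := by
  have key : ∀ (h : α → ℝ) (j : ℤ), levelSum rk Y h j =
      levelSum rk X h j + levelSum rk X (fun x => ∑ i ∈ s, h (f i x)) (j - 1) := by
    intro h j
    unfold levelSum
    rw [hsum, add_right_inj, Finset.sum_comm]
    refine Finset.sum_congr rfl fun x hx => ?_
    by_cases hj : (rk x : ℤ) = j - 1
    · rw [if_pos hj]
      refine Finset.sum_congr rfl fun i hi => if_pos ?_
      rw [hrk i hi x hx]
      push_cast
      omega
    · rw [if_neg hj]
      refine Finset.sum_eq_zero fun i hi => if_neg ?_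
      rw [hrk i hi x hx]
      push_cast
      omega
  have keySize : ∀ j : ℤ,
      levelSize rk Y j = levelSize rk X j + s.card * levelSize rk X (j - 1) := by
    intro j
    unfold levelSize
    rw [key, add_right_inj]
    simp only [levelSum, Finset.mul_sum]
    refine Finset.sum_congr rfl fun x _ => ?_
    split_ifs <;> simp
  constructor
  · intro h hh i
    have hm : (0 : ℝ) ≤ s.card := Nat.cast_nonneg _
    have hs := hX.average_mono h (fun x hx y hy => hh x (hsub hx) y (hsub hy)) i
    have ht := hX.average_mono (fun x => ∑ i ∈ s, h (f i x))
      (fun x hx y hy hxy => Finset.sum_le_sum fun i hi =>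
        hh _ (hmem i hi x hx) _ (hmem i hi y hy) (hmono i hi x hx y hy hxy)) (i - 1)
    have hst : (s.card : ℝ) * levelSum rk X h i ≤
        levelSum rk X (fun x => ∑ i ∈ s, h (f i x)) i := by
      simp only [levelSum, Finset.mul_sum]
      refine Finset.sum_le_sum fun x hx => ?_
      split_ifs with hi
      · rw [← nsmul_eq_mul]
        exact Finset.card_nsmul_le_sum _ _ _ fun i hi =>
          hh _ (hsub hx) _ (hmem i hi x hx) (hle i hi x hx)
      · simp
    have hlc := hX.logConcave (i - 1) i (by omega)
    rw [sub_add_cancel] at ht hlc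
    rw [keySize, keySize, key, key, add_sub_cancel_right]
    exact claw_average_le hm (levelSize_nonneg _) (levelSize_nonneg _) hs ht hst hlc
      (fun z => levelSum_eq_zero z _) (fun z => ⟨levelSum_eq_zero z _, levelSum_eq_zero z _⟩)
      (fun z => levelSum_eq_zero z _) (levelSize_nonneg _)
  · intro a b hab
    rcases hab.eq_or_lt with rfl | hab
    · rw [mul_comm]
    have hm : (0 : ℝ) ≤ s.card := Nat.cast_nonneg _
    have h1 := hX.logConcave a b hab.le
    have h2 := hX.logConcave (a - 1) b (by omega)
    have h3 := hX.logConcave a (b - 1) (by omega)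
    have h4 := hX.logConcave (a - 1) (b - 1) (by omega)
    rw [sub_add_cancel] at h2 h3 h4
    rw [sub_add_cancel] at h4
    simp only [keySize, add_sub_cancel_right]
    nlinarith [mul_le_mul_of_nonneg_left (h2.trans h3) hm,
      mul_le_mul_of_nonneg_left h4 (mul_nonneg hm hm)]

/-- A single element of rank `0` is a normalized log-concave poset. -/
theorem IsNormalizedLogConcave.singleton (le : α → α → Prop) {x : α} (hx : rk x = 0) :
    IsNormalizedLogConcave le rk {x} := by
  constructor
  · intro h _ i
    simp only [levelSize, levelSum, Finset.sum_singleton, hx, Nat.cast_zero]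
    split_ifs <;> first | omega | simp
  · intro a b hab
    simp only [levelSize, levelSum, Finset.sum_singleton, hx, Nat.cast_zero]
    split_ifs <;> first | omega | simp

end LevelSums

/-! ### From level averages to the strong Sperner property -/

section StrongSperner

/-- If `f ≤ N` are level sizes of a family that satisfies the LYM inequality `∑ fᵢ / Nᵢ ≤ k`, and
`I` consists of `k` largest levels, then the family is no larger than the union of these levels. -/
theorem sum_le_sum_of_lym {J I : Finset ℕ} {f N : ℕ → ℝ} (hIJ : I ⊆ J)
    (hN : ∀ i ∈ J, 0 < N i) (hf : ∀ i ∈ J, 0 ≤ f i) (hfN : ∀ i ∈ J, f i ≤ N i)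
    (hI : I.Nonempty) (hlarge : ∀ i ∈ I, ∀ j ∈ J, j ∉ I → N j ≤ N i)
    (hlym : ∑ i ∈ J, f i / N i ≤ I.card) : ∑ i ∈ J, f i ≤ ∑ i ∈ I, N i := by
  obtain ⟨i₀, hi₀, hmin⟩ := I.exists_min_image N hI
  have hM := hN i₀ (hIJ hi₀)
  -- The smallest size `N i₀` in `I` is a threshold: inside `I`, where `f i / N i - 1 ≤ 0`, it is at
  -- most `N i`, and outside `I`, where `f i / N i ≥ 0`, it is at least `N i`.
  have hterm : ∀ i ∈ J, f i - (if i ∈ I then N i else 0) ≤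
      N i₀ * (f i / N i - if i ∈ I then 1 else 0) := by
    intro i hi
    have hNi := hN i hi
    have hfi : f i = N i * (f i / N i) := by field_simp
    split_ifs with hiI
    · have h1 : f i / N i ≤ 1 := (div_le_one hNi).2 (hfN i hi)
      nlinarith [hmin i hiI]
    · have h1 : 0 ≤ f i / N i := div_nonneg (hf i hi) hNi.le
      nlinarith [hlarge i₀ hi₀ i hi hiI]
  have hsum := Finset.sum_le_sum hterm
  rw [← Finset.mul_sum, Finset.sum_sub_distrib, Finset.sum_sub_distrib, Finset.sum_ite_mem,
    Finset.sum_ite_mem, Finset.inter_eq_right.2 hIJ, Finset.sum_const, nsmul_eq_mul, mul_one]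
    at hsum
  nlinarith

section ChainHeight

variable {P : Type*} [PartialOrder P] [Fintype P]

open Classical in
/-- The largest number of elements in a chain of members of `F` that lie below `x`. -/
noncomputable def chainHeight (F : Set P) (x : P) : ℕ :=
  (Finset.univ.filter fun C : Finset P =>
    (C : Set P) ⊆ F ∧ IsChain (· ≤ ·) (C : Set P) ∧ ∀ y ∈ C, y ≤ x).sup Finset.card

theorem le_chainHeight {F : Set P} {x : P} {C : Finset P} (hF : (C : Set P) ⊆ F)
    (hC : IsChain (· ≤ ·) (C : Set P)) (hx : ∀ y ∈ C, y ≤ x) : C.card ≤ chainHeight F x := by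
  classical
  exact Finset.le_sup (f := Finset.card) (by simp [hF, hC]; exact hx)

theorem exists_chainHeight (F : Set P) (x : P) : ∃ C : Finset P, (C : Set P) ⊆ F ∧
    IsChain (· ≤ ·) (C : Set P) ∧ (∀ y ∈ C, y ≤ x) ∧ C.card = chainHeight F x := by
  classical
  obtain ⟨C, hC, hcard⟩ := Finset.exists_mem_eq_sup
    (Finset.univ.filter fun C : Finset P =>
      (C : Set P) ⊆ F ∧ IsChain (· ≤ ·) (C : Set P) ∧ ∀ y ∈ C, y ≤ x)
    ⟨∅, by simp⟩ Finset.card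
  simp only [Finset.mem_filter, Finset.mem_univ, true_and] at hC
  exact ⟨C, hC.1, hC.2.1, hC.2.2, by rw [chainHeight, hcard]⟩

theorem chainHeight_le {F : Set P} {k : ℕ} (hF : IsKFamily k F) (x : P) :
    chainHeight F x ≤ k := by
  by_contra! hlt
  obtain ⟨C, hCF, hC, -, hcard⟩ := exists_chainHeight F x
  obtain ⟨D, hDC, hD⟩ := Finset.exists_subset_card_eq (s := C) (n := k + 1) (by omega)
  exact hF ⟨D, fun y hy => hCF (hDC hy), hC.mono (by exact_mod_cast hDC), hD⟩

theorem chainHeight_lt {F : Set P} {x y : P} (hy : y ∈ F) (hxy : x < y) :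
    chainHeight F x + 1 ≤ chainHeight F y := by
  classical
  obtain ⟨C, hCF, hC, hCx, hcard⟩ := exists_chainHeight F x
  have hyC : y ∉ C := fun h => (hCx y h).not_gt hxy
  rw [← hcard, ← Finset.card_insert_of_notMem hyC]
  refine le_chainHeight ?_ ?_ ?_
  · rw [Finset.coe_insert]
    exact Set.insert_subset hy hCF
  · rw [Finset.coe_insert]
    exact hC.insert fun z hz _ => Or.inr ((hCx z hz).trans hxy.le)
  · intro z hz
    rcases Finset.mem_insert.1 hz with rfl | hz
    · exact le_rfl
    · exact (hCx z hz).trans hxy.le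

theorem chainHeight_mono (F : Set P) {x y : P} (hxy : x ≤ y) :
    chainHeight F x ≤ chainHeight F y := by
  obtain ⟨C, hCF, hC, hCx, hcard⟩ := exists_chainHeight F x
  exact hcard ▸ le_chainHeight hCF hC fun z hz => (hCx z hz).trans hxy

theorem one_le_chainHeight {F : Set P} {x : P} (hx : x ∈ F) : 1 ≤ chainHeight F x := by
  simpa using le_chainHeight (C := {x}) (x := x) (by simpa using hx) (by simp) (by simp)

end ChainHeight

variable {P : Type*} [PartialOrder P] [GradeMinOrder ℕ P]

theorem isKFamily_biUnion_rankLevel (I : Finset ℕ) :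
    IsKFamily I.card (⋃ i ∈ I, rankLevel P i) := by
  rintro ⟨C, hCF, hC, hcard⟩
  have hinj : Set.InjOn (grade ℕ) (C : Set P) := by
    intro x hx y hy hxy
    by_contra hne
    rcases hC hx hy hne with h | h
    · exact (grade_strictMono (lt_of_le_of_ne h hne)).ne hxy
    · exact (grade_strictMono (lt_of_le_of_ne h (Ne.symm hne))).ne hxy.symm
  have := Finset.card_le_card_of_injOn (t := I) (grade ℕ) (fun x hx => by
    have := hCF hx
    simp only [Set.mem_iUnion, rankLevel, Set.mem_ofPred_eq] at this
    obtain ⟨i, hi, rfl⟩ := this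
    exact hi) hinj
  omega

variable [Fintype P]

theorem levelSize_eq_ncard (i : ℕ) :
    levelSize (grade ℕ) (Finset.univ : Finset P) i = (rankLevel P i).ncard := by
  classical
  have : rankLevel P i = ((Finset.univ.filter fun x : P => grade ℕ x = i : Finset P) : Set P) := by
    ext; simp [rankLevel]
  rw [this, Set.ncard_coe_finset, levelSize, levelSum]
  simp [Finset.sum_boole]

open Classical in
theorem levelSum_indicator (F : Set P) (i : ℕ) :
    levelSum (grade ℕ) (Finset.univ : Finset P) (fun x => if x ∈ F then 1 else 0) i =
      (F ∩ rankLevel P i).ncard := by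
  have : F ∩ rankLevel P i =
      ((Finset.univ.filter fun x : P => grade ℕ x = i ∧ x ∈ F : Finset P) : Set P) := by
    ext; simp [rankLevel, and_comm]
  rw [this, Set.ncard_coe_finset, levelSum]
  simp [← ite_and, Finset.sum_boole]

theorem levelSize_pos_of_le [Nonempty P]
    (hP : IsNormalizedLogConcave (· ≤ ·) (grade ℕ) (Finset.univ : Finset P)) {i : ℕ}
    (hi : i ≤ posetRank P) : 0 < levelSize (grade ℕ) (Finset.univ : Finset P) i := by
  have htop : 0 < levelSize (grade ℕ) (Finset.univ : Finset P) (posetRank P) := by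
    obtain ⟨x, hx⟩ := Nat.sSup_mem (Set.range_nonempty fun x : P => grade ℕ x)
      (Set.finite_range _).bddAbove
    have := levelSize_pos (rk := grade ℕ) (Finset.mem_univ x)
    rwa [show grade ℕ x = posetRank P from hx] at this
  have hbot : 0 < levelSize (grade ℕ) (Finset.univ : Finset P) 0 := by
    obtain ⟨x, hx⟩ := Set.finite_univ.exists_minimal (Set.univ_nonempty (α := P))
    have hmin : IsMin x := fun y hy => hx.le_of_le (Set.mem_univ y) hy
    have h0 : grade ℕ x = 0 := (hmin.grade ℕ).eq_bot
    simpa [h0] using levelSize_pos (rk := grade ℕ) (Finset.mem_univ x)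
  -- Level sizes have no internal zeros: `N 0 * N (j + 1) ≤ N 1 * N j`.
  induction hi using Nat.decreasingInduction with
  | self => exact htop
  | of_succ j _ ih =>
    have h := hP.logConcave 0 j (by positivity)
    refine (levelSize_nonneg _).lt_of_ne fun h0 => ?_
    rw [← h0, mul_zero] at h
    push_cast at ih
    exact absurd h (mul_pos hbot ih).not_ge

/-- The LYM inequality for `k`-families. The average of `chainHeight F` over a level is at most
`k`, and it grows by at least the density of `F` from each level to the next. -/
theorem lym_of_isKFamily [Nonempty P]
    (hP : IsNormalizedLogConcave (· ≤ ·) (grade ℕ) (Finset.univ : Finset P)) {k : ℕ} {F : Set P}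
    (hF : IsKFamily k F) :
    ∑ i ∈ Finset.range (posetRank P + 1),
      ((F ∩ rankLevel P i).ncard : ℝ) / (rankLevel P i).ncard ≤ k := by
  classical
  set N : ℤ → ℝ := levelSize (grade ℕ) (Finset.univ : Finset P)
  set S : ℤ → ℝ := levelSum (grade ℕ) (Finset.univ : Finset P) fun x => chainHeight F x
  have hstep : ∀ j : ℕ, j ≤ posetRank P →
      ∑ i ∈ Finset.range (j + 1),
        ((F ∩ rankLevel P i).ncard : ℝ) / (rankLevel P i).ncard ≤ S j / N j := by
    intro j
    induction j with
    | zero =>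
      intro h0
      rw [Finset.sum_range_one, ← levelSize_eq_ncard]
      refine div_le_div_of_nonneg_right ?_ (levelSize_nonneg _)
      rw [← levelSum_indicator]
      refine levelSum_mono fun x _ _ => ?_
      split_ifs with hx
      · exact_mod_cast one_le_chainHeight hx
      · positivity
    | succ j ih =>
      intro hj
      rw [Finset.sum_range_succ]
      have hNj := levelSize_pos_of_le hP (show j ≤ posetRank P by omega)
      have hNj' := levelSize_pos_of_le hP hj
      -- Lowering the height by one on the members of `F` above rank `j` keeps it monotone.
      have h := hP.average_mono
        (fun x => (chainHeight F x : ℝ) - if j + 1 ≤ grade ℕ x ∧ x ∈ F then 1 else 0) (by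
          intro x _ y _ hxy
          rcases hxy.eq_or_lt with rfl | hlt
          · exact le_rfl
          have hx0 : (0 : ℝ) ≤ if j + 1 ≤ grade ℕ x ∧ x ∈ F then 1 else 0 := by positivity
          have hxy' : (chainHeight F x : ℝ) ≤ chainHeight F y := by
            exact_mod_cast chainHeight_mono F hxy
          split_ifs with hx hy hy
          · linarith
          · linarith
          · have : (chainHeight F x : ℝ) + 1 ≤ chainHeight F y := by
              exact_mod_cast chainHeight_lt hy.2 hlt
            linarith
          · linarith) j
      rw [levelSum_congr (i := (j : ℤ)) (h := fun x => (chainHeight F x : ℝ)) (by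
          intro x _ hx
          have hx' : ¬ (j + 1 ≤ grade ℕ x ∧ x ∈ F) := fun h => by omega
          simp only [if_neg hx', sub_zero]),
        levelSum_congr (i := (j : ℤ) + 1)
          (h := fun x => (chainHeight F x : ℝ) - if x ∈ F then 1 else 0) (by
          intro x _ hx
          have hx' : j + 1 ≤ grade ℕ x := by omega
          simp only [hx', true_and]), levelSum_sub] at h
      have hI := levelSum_indicator F (j + 1)
      rw [Nat.cast_add, Nat.cast_one] at hI
      rw [hI] at h
      have h' : S j / N j + ((F ∩ rankLevel P (j + 1)).ncard : ℝ) / N ((j + 1 : ℕ) : ℤ) ≤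
          S ((j + 1 : ℕ) : ℤ) / N ((j + 1 : ℕ) : ℤ) := by
        rw [← le_sub_iff_add_le, ← sub_div, div_le_div_iff₀ hNj hNj']
        push_cast
        linarith
      rw [← levelSize_eq_ncard (j + 1)]
      linarith [ih (by omega)]
  refine (hstep _ le_rfl).trans ?_
  rw [div_le_iff₀ (levelSize_pos_of_le hP le_rfl)]
  have : S (posetRank P) ≤
      levelSum (grade ℕ) (Finset.univ : Finset P) (fun _ => (k : ℝ)) (posetRank P) :=
    levelSum_mono fun x _ _ => by exact_mod_cast chainHeight_le hF x
  refine this.trans_eq ?_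
  simp only [levelSize, levelSum, Finset.mul_sum]
  exact Finset.sum_congr rfl fun x _ => by split_ifs <;> simp

theorem ncard_eq_sum_rankLevel (F : Set P) :
    F.ncard = ∑ i ∈ Finset.range (posetRank P + 1), (F ∩ rankLevel P i).ncard := by
  classical
  have hle : ∀ x : P, grade ℕ x ≤ posetRank P := fun x =>
    le_csSup (Set.finite_range _).bddAbove ⟨x, rfl⟩
  rw [Set.ncard_eq_toFinset_card', Finset.card_eq_sum_card_fiberwise (f := grade ℕ)
    (t := Finset.range (posetRank P + 1)) (fun x _ => by simpa [Nat.lt_succ_iff] using hle x)]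
  refine Finset.sum_congr rfl fun i _ => ?_
  rw [Set.ncard_eq_toFinset_card']
  congr 1
  ext x
  simp only [Finset.mem_filter, Set.mem_toFinset]
  rfl

theorem isStrongSperner_of_isNormalizedLogConcave [Nonempty P]
    (hP : IsNormalizedLogConcave (· ≤ ·) (grade ℕ) (Finset.univ : Finset P)) :
    IsStrongSperner P := by
  refine ⟨inferInstance, fun k hk _ I ⟨hI, hcard, hlarge⟩ => ⟨hcard ▸ isKFamily_biUnion_rankLevel I,
    fun F hF => ?_⟩⟩
  have hunion : (⋃ i ∈ I, rankLevel P i).ncard = ∑ i ∈ I, (rankLevel P i).ncard := by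
    rw [ncard_eq_sum_rankLevel, ← Finset.sum_subset hI]
    · refine Finset.sum_congr rfl fun i hi => ?_
      rw [Set.inter_eq_right.2 (Set.subset_iUnion₂ (s := fun i (_ : i ∈ I) => rankLevel P i) i hi)]
    · intro j _ hj
      rw [Set.ncard_eq_zero]
      ext x
      simp only [rankLevel, Set.mem_inter_iff, Set.mem_iUnion, Set.mem_ofPred_eq, exists_prop,
        exists_eq_right', Set.mem_empty_iff_false, iff_false]
      rintro ⟨hx, rfl⟩
      exact hj hx
  rw [ncard_eq_sum_rankLevel F, hunion]
  have := sum_le_sum_of_lym (f := fun i => ((F ∩ rankLevel P i).ncard : ℝ))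
    (N := fun i => ((rankLevel P i).ncard : ℝ)) hI
    (fun i hi => by
      rw [← levelSize_eq_ncard]
      exact levelSize_pos_of_le hP (Nat.lt_succ_iff.1 (Finset.mem_range.1 hi)))
    (fun i _ => Nat.cast_nonneg _)
    (fun i _ => by exact_mod_cast Set.ncard_le_ncard Set.inter_subset_right)
    (Finset.card_pos.1 (by omega)) (fun i hi j hj hjI => by exact_mod_cast hlarge i hi j hj hjI)
    (hcard ▸ lym_of_isKFamily hP hF)
  exact_mod_cast this

end StrongSperner

/-! ### Absolute length -/

section AbsLength

variable {B W : Type*} [Group W] {M : CoxeterMatrix B} (cs : CoxeterSystem M W)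

theorem absLength_le_one {t : W} (ht : cs.IsReflection t) : absLength cs t ≤ 1 := by
  simpa using absLength_le cs (l := [t]) (by simpa using ht)

theorem absLength_mul_le_add_one {t : W} (ht : cs.IsReflection t) (w : W) :
    absLength cs (t * w) ≤ absLength cs w + 1 := by
  have := absLength_mul_le cs t w
  have := absLength_le_one cs ht
  omega

/-- If `t` is a reflection with `l_T(t w) = l_T(w) + 1`, then `w ≤ t w` in the absolute order:
`w⁻¹ t w` is a reflection, too. -/
theorem absLength_mul_eq_of_isReflection {t w : W} (ht : cs.IsReflection t)
    (h : absLength cs (t * w) = absLength cs w + 1) :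
    absLength cs (t * w) = absLength cs w + absLength cs (w⁻¹ * (t * w)) := by
  have h1 : absLength cs (w⁻¹ * (t * w)) ≤ 1 :=
    absLength_le_one cs (by simpa [mul_assoc] using ht.conj w⁻¹)
  have h2 := absLength_le_add cs w (t * w)
  omega

/-- In a linear representation in which every simple reflection `s` satisfies
`rank (ρ s - 1) ≤ 1`, the rank of `ρ w - 1` is a lower bound for the absolute length of `w`. -/
theorem rank_sub_one_le_absLength {K V : Type*} [Field K] [AddCommGroup V] [Module K V]
    (ρ : W →* Module.End K V) (hρ : ∀ i, (ρ (cs.simple i) - 1).rank ≤ 1) (w : W) :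
    (ρ w - 1).rank ≤ (absLength cs w : Cardinal) := by
  have hrefl : ∀ t, cs.IsReflection t → (ρ t - 1).rank ≤ 1 := by
    rintro t ⟨g, i, rfl⟩
    have : ρ (g * cs.simple i * g⁻¹) - 1 = ρ g ∘ₗ (ρ (cs.simple i) - 1) ∘ₗ ρ g⁻¹ := by
      have h1 : ρ g * ρ g⁻¹ = 1 := by rw [← map_mul, mul_inv_cancel, map_one]
      change _ = ρ g * ((ρ (cs.simple i) - 1) * ρ g⁻¹)
      rw [sub_mul, one_mul, mul_sub, h1, map_mul, map_mul, mul_assoc]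
    rw [this]
    exact (LinearMap.rank_comp_le_right _ _).trans ((LinearMap.rank_comp_le_left _ _).trans (hρ i))
  have hword : ∀ l : List W, (∀ t ∈ l, cs.IsReflection t) →
      (ρ l.prod - 1).rank ≤ (l.length : Cardinal) := by
    intro l
    induction l with
    | nil => intro _; simp
    | cons t l ih =>
      intro hl
      have : ρ (t :: l).prod - 1 = (ρ l.prod - 1) + (ρ t - 1) ∘ₗ ρ l.prod := by
        change _ = (ρ l.prod - 1) + (ρ t - 1) * ρ l.prod
        rw [List.prod_cons, map_mul, sub_mul, one_mul]
        abel
      rw [this, List.length_cons, Nat.cast_add, Nat.cast_one]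
      exact (LinearMap.rank_add_le _ _).trans (add_le_add
        (ih fun u hu => hl u (List.mem_cons_of_mem _ hu))
        ((LinearMap.rank_comp_le_left _ _).trans (hrefl t (hl t List.mem_cons_self))))
  obtain ⟨l, hl, hlr, rfl⟩ := absLength_exists cs w
  exact hl ▸ hword l hlr

end AbsLength

/-! ### Coset representatives in a chain of parabolic subgroups -/

section Parabolic

variable {W : Type*} [Group W] (r : ℕ → W)

/-- The element `r_k ⋯ r_1 r_0 r_1 ⋯ r_k`. For signed permutations, it changes the sign of the
`k`-th coordinate. -/
def signElement : ℕ → W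
  | 0 => r 0
  | k + 1 => r (k + 1) * signElement k * r (k + 1)

/-- The subgroup generated by `r_0, …, r_{k-1}`. -/
def parabolic (k : ℕ) : Subgroup W := Subgroup.closure (r '' {i | i < k})

section

variable {r}

theorem mem_parabolic {i k : ℕ} (hi : i < k) : r i ∈ parabolic r k :=
  Subgroup.subset_closure ⟨i, hi, rfl⟩

theorem parabolic_mono {j k : ℕ} (h : j ≤ k) : parabolic r j ≤ parabolic r k :=
  Subgroup.closure_mono (Set.image_mono fun _ hi => lt_of_lt_of_le hi h)

theorem signElement_mem_parabolic (k : ℕ) : signElement r k ∈ parabolic r (k + 1) := by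
  induction k with
  | zero => exact mem_parabolic (by omega)
  | succ k ih =>
    have hr : r (k + 1) ∈ parabolic r (k + 1 + 1) := mem_parabolic (by omega)
    exact mul_mem (mul_mem hr (parabolic_mono (by omega) ih)) hr

end

variable [DecidableEq W]

/-- Representatives of the left cosets of `⟨r_i : i < k⟩` in `⟨r_i : i ≤ k⟩`: the identity and
some reflections. For signed permutations, these are all reflections of `⟨r_i : i ≤ k⟩` that move
the last of the `k + 1` coordinates. -/
def cosetReps : ℕ → Finset W
  | 0 => {1, r 0}
  | k + 1 => insert 1 (insert (signElement r (k + 1))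
      ((cosetReps k).image fun c => c * r (k + 1) * c⁻¹))

/-- The products `c_{k-1} ⋯ c_1 c_0` of coset representatives; they will turn out to be all elements
of `⟨r_i : i < k⟩`. -/
def cosetProducts : ℕ → Finset W
  | 0 => {1}
  | k + 1 => cosetReps r k * cosetProducts k

variable {r}

theorem one_mem_cosetReps (k : ℕ) : 1 ∈ cosetReps r k := by
  cases k <;> simp [cosetReps]

theorem signElement_mem_cosetReps (k : ℕ) : signElement r k ∈ cosetReps r k := by
  cases k <;> simp [cosetReps, signElement]

theorem conj_mem_cosetReps {k : ℕ} {c : W} (hc : c ∈ cosetReps r k) :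
    c * r (k + 1) * c⁻¹ ∈ cosetReps r (k + 1) :=
  Finset.mem_insert_of_mem (Finset.mem_insert_of_mem (Finset.mem_image_of_mem _ hc))

/-- The cases of membership in `cosetReps`, uniformly in `k`. -/
theorem cosetReps_cases {k : ℕ} {c : W} (hc : c ∈ cosetReps r k) :
    c = 1 ∨ c = signElement r k ∨
      ∃ j, k = j + 1 ∧ ∃ e ∈ cosetReps r j, c = e * r k * e⁻¹ := by
  cases k with
  | zero =>
    rcases Finset.mem_insert.1 hc with h | h
    · exact Or.inl h
    · exact Or.inr (Or.inl (Finset.mem_singleton.1 h))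
  | succ j =>
    rcases Finset.mem_insert.1 hc with h | h
    · exact Or.inl h
    rcases Finset.mem_insert.1 h with h | h
    · exact Or.inr (Or.inl h)
    obtain ⟨e, he, rfl⟩ := Finset.mem_image.1 h
    exact Or.inr (Or.inr ⟨j, rfl, e, he, rfl⟩)

theorem cosetReps_subset_parabolic (k : ℕ) : ∀ c ∈ cosetReps r k, c ∈ parabolic r (k + 1) := by
  induction k with
  | zero =>
    intro c hc
    rcases cosetReps_cases hc with rfl | rfl | ⟨j, hj, -⟩
    · exact one_mem _
    · exact signElement_mem_parabolic 0
    · omega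
  | succ k ih =>
    intro c hc
    rcases cosetReps_cases hc with rfl | rfl | ⟨j, hj, e, he, rfl⟩
    · exact one_mem _
    · exact signElement_mem_parabolic _
    · obtain rfl : k = j := by omega
      have he' := parabolic_mono (show k + 1 ≤ k + 1 + 1 by omega) (ih e he)
      exact mul_mem (mul_mem he' (mem_parabolic (by omega))) (inv_mem he')

theorem cosetProducts_subset_parabolic (k : ℕ) : ∀ h ∈ cosetProducts r k, h ∈ parabolic r k := by
  induction k with
  | zero =>
    intro h hh
    rw [cosetProducts, Finset.mem_singleton] at hh
    exact hh ▸ one_mem _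
  | succ k ih =>
    intro h hh
    obtain ⟨c, hc, g, hg, rfl⟩ := Finset.mem_mul.1 hh
    exact mul_mem (cosetReps_subset_parabolic k c hc) (parabolic_mono (by omega) (ih g hg))

end Parabolic

/-! ### The relations of type `B` -/

/-- The relations of type `B_N` between `r_0, …, r_{N-1}`, with the double bond between `r_0` and
`r_1`. The order of an element is only bounded: in type `A_{N-1}` these relations hold with
`r_0 = 1`, which permits a common treatment of both types. -/
structure IsTypeB {W : Type*} [Group W] (r : ℕ → W) (N : ℕ) : Prop where
  mul_self : ∀ i < N, r i * r i = 1
  comm : ∀ i j, i + 1 < j → j < N → r i * r j = r j * r i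
  braid : ∀ i, 0 < i → i + 1 < N → r i * r (i + 1) * r i = r (i + 1) * r i * r (i + 1)
  braid_zero : 1 < N → r 0 * r 1 * r 0 * r 1 = r 1 * r 0 * r 1 * r 0

namespace IsTypeB

variable {W : Type*} [Group W] {r : ℕ → W} {N : ℕ} (hr : IsTypeB r N)
include hr

theorem mul_self_mul {i : ℕ} (hi : i < N) (w : W) : r i * (r i * w) = w := by
  rw [← mul_assoc, hr.mul_self i hi, one_mul]

theorem inv_eq {i : ℕ} (hi : i < N) : (r i)⁻¹ = r i :=
  inv_eq_of_mul_eq_one_left (hr.mul_self i hi)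

theorem commute_of_mem_parabolic {k : ℕ} (hk : k + 1 < N) {h : W} (hh : h ∈ parabolic r k) :
    Commute (r (k + 1)) h := by
  induction hh using Subgroup.closure_induction with
  | mem x hx =>
    obtain ⟨i, hi, rfl⟩ := hx
    exact (hr.comm i (k + 1) (by simpa using hi) hk).symm
  | one => exact Commute.one_right _
  | mul x y _ _ hx hy => exact hx.mul_right hy
  | inv x _ hx => exact hx.inv_right

theorem commute_signElement {k : ℕ} (hk : k < N) {i : ℕ} (hi : i < k) :
    Commute (r i) (signElement r k) := by
  induction k with
  | zero => omega
  | succ k ih =>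
    rcases Nat.lt_succ_iff_lt_or_eq.1 hi with hik | rfl
    · have h1 : Commute (r i) (r (k + 1)) := hr.comm i (k + 1) (by omega) hk
      exact (h1.mul_right (ih (by omega) hik)).mul_right h1
    · cases i with
      | zero =>
        have h := hr.braid_zero hk
        change r 0 * (r 1 * r 0 * r 1) = r 1 * r 0 * r 1 * r 0
        rw [← h]
        simp only [mul_assoc]
      | succ i =>
        have hb := hr.braid (i + 1) (by omega) hk
        have hc : Commute (r (i + 1 + 1)) (signElement r i) :=
          hr.commute_of_mem_parabolic hk (signElement_mem_parabolic i)
        set a := r (i + 1)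
        set b := r (i + 1 + 1)
        set q := signElement r i
        change a * (b * (a * q * a) * b) = b * (a * q * a) * b * a
        calc a * (b * (a * q * a) * b) = (a * b * a) * q * a * b := by simp only [mul_assoc]
          _ = b * a * (b * q) * a * b := by rw [hb]; simp only [mul_assoc]
          _ = b * a * q * (b * a * b) := by rw [hc.eq]; simp only [mul_assoc]
          _ = b * (a * q * a) * b * a := by rw [← hb]; simp only [mul_assoc]

/-- The parabolic subgroup `⟨r_i : i ≤ k⟩` is the union of the left cosets of `⟨r_i : i < k⟩` by
the elements of `cosetReps r k`. -/
theorem exists_cosetReps_mul [DecidableEq W] {k : ℕ} (hk : k < N) {w : W}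
    (hw : w ∈ parabolic r (k + 1)) : ∃ c ∈ cosetReps r k, ∃ h ∈ parabolic r k, w = c * h := by
  induction k generalizing w with
  | zero =>
    have hmul : ∀ w : W, (∃ c ∈ cosetReps r 0, ∃ h ∈ parabolic r 0, w = c * h) →
        ∃ c ∈ cosetReps r 0, ∃ h ∈ parabolic r 0, r 0 * w = c * h := by
      rintro w ⟨c, hc, h, hh, rfl⟩
      rcases cosetReps_cases hc with rfl | rfl | ⟨j, hj, -⟩
      · exact ⟨r 0, signElement_mem_cosetReps 0, h, hh, by rw [one_mul]⟩
      · exact ⟨1, one_mem_cosetReps 0, h, hh, by rw [one_mul]; exact hr.mul_self_mul hk h⟩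
      · omega
    induction hw using Subgroup.closure_induction_left with
    | one => exact ⟨1, one_mem_cosetReps 0, 1, one_mem _, by simp⟩
    | mul_left x hx y _ ih =>
      obtain ⟨i, hi, rfl⟩ := hx
      obtain rfl : i = 0 := by simpa using hi
      exact hmul y ih
    | inv_mul_cancel x hx y _ ih =>
      obtain ⟨i, hi, rfl⟩ := hx
      obtain rfl : i = 0 := by simpa using hi
      rw [hr.inv_eq hk]
      exact hmul y ih
  | succ k IH =>
    have hk' : k < N := by omega
    set b := r (k + 1) with hb
    have hbb : ∀ w, b * (b * w) = w := hr.mul_self_mul hk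
    have hmul : ∀ i < k + 1 + 1, ∀ w : W,
        (∃ c ∈ cosetReps r (k + 1), ∃ h ∈ parabolic r (k + 1), w = c * h) →
        ∃ c ∈ cosetReps r (k + 1), ∃ h ∈ parabolic r (k + 1), r i * w = c * h := by
      -- It suffices to reach a product `c * b * h`, which lies in the coset of `c * b * c⁻¹`.
      have hcoset : ∀ c ∈ cosetReps r k, ∀ h ∈ parabolic r (k + 1), ∀ w, w = c * (b * h) →
          ∃ c ∈ cosetReps r (k + 1), ∃ h ∈ parabolic r (k + 1), w = c * h := by
        rintro c hc h hh w rfl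
        exact ⟨_, conj_mem_cosetReps hc, c * h,
          mul_mem (cosetReps_subset_parabolic k c hc) hh, by simp only [mul_assoc, ← hb]; group⟩
      rintro i hi w ⟨c, hc, h, hh, rfl⟩
      rcases Nat.lt_succ_iff_lt_or_eq.1 hi with hik | rfl
      · have hri : r i ∈ parabolic r (k + 1) := mem_parabolic hik
        rcases cosetReps_cases hc with rfl | rfl | ⟨j, hj, e, he, rfl⟩
        · exact ⟨1, hc, r i * h, mul_mem hri hh, by simp⟩
        · refine ⟨_, hc, r i * h, mul_mem hri hh, ?_⟩
          rw [← mul_assoc, (hr.commute_signElement hk hik).eq, mul_assoc]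
        · obtain rfl : k = j := by omega
          have he' := cosetReps_subset_parabolic k e he
          obtain ⟨c', hc', h', hh', heq⟩ := IH hk' (mul_mem hri he')
          refine hcoset c' hc' (h' * (e⁻¹ * h)) (mul_mem (parabolic_mono (by omega) hh')
            (mul_mem (inv_mem he') hh)) _ ?_
          have hcomm : b * h' = h' * b := (hr.commute_of_mem_parabolic hk hh').eq
          calc r i * (e * b * e⁻¹ * h) = (r i * e) * (b * (e⁻¹ * h)) := by simp only [mul_assoc]
            _ = c' * ((h' * b) * (e⁻¹ * h)) := by rw [heq]; simp only [mul_assoc]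
            _ = c' * (b * (h' * (e⁻¹ * h))) := by rw [← hcomm]; simp only [mul_assoc]
      · rcases cosetReps_cases hc with rfl | rfl | ⟨j, hj, e, he, rfl⟩
        · exact hcoset 1 (one_mem_cosetReps k) h hh _ (by simp [hb])
        · refine hcoset _ (signElement_mem_cosetReps k) h hh _ ?_
          change b * (b * signElement r k * b * h) = _
          simp only [mul_assoc, hbb]
        · obtain rfl : k = j := by omega
          have he' := cosetReps_subset_parabolic k e he
          rw [← hb]
          rcases cosetReps_cases he with rfl | rfl | ⟨j, rfl, f, hf, rfl⟩
          · exact ⟨1, one_mem_cosetReps _, h, hh, by simp [hbb]⟩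
          · refine ⟨_, signElement_mem_cosetReps (k + 1), (signElement r k)⁻¹ * h,
              mul_mem (inv_mem he') hh, ?_⟩
            rw [signElement, ← hb]
            simp only [mul_assoc]
          · set a := r (j + 1) with ha
            have hf' := cosetReps_subset_parabolic j f hf
            have hfc : b * f = f * b := (hr.commute_of_mem_parabolic hk hf').eq
            have hfc' : b * f⁻¹ = f⁻¹ * b := (hr.commute_of_mem_parabolic hk (inv_mem hf')).eq
            have hbr : b * a * b = a * b * a := (hr.braid (j + 1) (by omega) hk).symm
            set e := f * a * f⁻¹ with he_def
            refine hcoset e he (e * (e⁻¹ * h)) (mul_mem he' (mul_mem (inv_mem he') hh)) _ ?_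
            -- Conjugating the braid relation by `f` turns it into one between `b` and `e`.
            have hbe : b * e * b = e * b * e := by
              calc b * (f * a * f⁻¹) * b = (b * f) * a * (f⁻¹ * b) := by simp only [mul_assoc]
                _ = f * (b * a * b) * f⁻¹ := by rw [hfc, ← hfc']; simp only [mul_assoc]
                _ = (f * a) * b * (a * f⁻¹) := by rw [hbr]; simp only [mul_assoc]
                _ = (f * a * f⁻¹) * (f * b) * (a * f⁻¹) := by group
                _ = (f * a * f⁻¹) * b * (f * a * f⁻¹) := by rw [← hfc]; simp only [mul_assoc]
            calc b * (e * b * e⁻¹ * h) = (b * e * b) * (e⁻¹ * h) := by simp only [mul_assoc]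
              _ = e * (b * (e * (e⁻¹ * h))) := by rw [hbe]; simp only [mul_assoc]
    induction hw using Subgroup.closure_induction_left with
    | one => exact ⟨1, one_mem_cosetReps _, 1, one_mem _, by simp⟩
    | mul_left x hx y _ ih =>
      obtain ⟨i, hi, rfl⟩ := hx
      exact hmul i hi y ih
    | inv_mul_cancel x hx y _ ih =>
      obtain ⟨i, hi, rfl⟩ := hx
      have hi' : i < k + 1 + 1 := hi
      rw [hr.inv_eq (by omega)]
      exact hmul i hi y ih

theorem mem_cosetProducts [DecidableEq W] {k : ℕ} (hk : k ≤ N) {w : W}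
    (hw : w ∈ parabolic r k) : w ∈ cosetProducts r k := by
  induction k generalizing w with
  | zero =>
    rw [parabolic, show {i | i < 0} = (∅ : Set ℕ) by simp, Set.image_empty, Subgroup.closure_empty,
      Subgroup.mem_bot] at hw
    simp [cosetProducts, hw]
  | succ k ih =>
    obtain ⟨c, hc, h, hh, rfl⟩ := hr.exists_cosetReps_mul (by omega) hw
    exact Finset.mul_mem_mul hc (ih (by omega) hh)

end IsTypeB

/-! ### The signed permutation representation -/

section SignedSwap

/-- The action of the generators of type `B` on `ℕ → ℚ`: the sign change of the coordinate `0`, and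
the interchanges of the coordinates `i` and `i + 1`. Infinitely many coordinates are used to have
one space for all ranks. -/
def signedSwap : ℕ → Module.End ℚ (ℕ → ℚ)
  | 0 => LinearMap.pi fun j => (if j = 0 then -1 else 1 : ℚ) • LinearMap.proj j
  | i + 1 => LinearMap.funLeft ℚ ℚ (Equiv.swap i (i + 1))

theorem signedSwap_zero_apply (v : ℕ → ℚ) (j : ℕ) :
    signedSwap 0 v j = (if j = 0 then -1 else 1) * v j := rfl

theorem signedSwap_succ_apply (i : ℕ) (v : ℕ → ℚ) (j : ℕ) :
    signedSwap (i + 1) v j = v (Equiv.swap i (i + 1) j) := rfl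

theorem signedSwap_apply_of_lt {i j : ℕ} (h : i < j) (v : ℕ → ℚ) : signedSwap i v j = v j := by
  cases i with
  | zero => simp [signedSwap_zero_apply, h.ne']
  | succ i =>
    rw [signedSwap_succ_apply, Equiv.swap_apply_of_ne_of_ne (by omega) (by omega)]

theorem signedSwap_zero_single : signedSwap 0 (Pi.single 0 1) = -Pi.single 0 1 := by
  ext j
  rcases eq_or_ne j 0 with rfl | hj <;> simp [signedSwap_zero_apply, *]

theorem signedSwap_succ_single (i j : ℕ) :
    signedSwap (i + 1) (Pi.single j 1) = Pi.single (Equiv.swap i (i + 1) j) 1 := by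
  ext l
  simp only [signedSwap_succ_apply, Pi.single_apply, Equiv.swap_apply_eq_iff]

theorem signedSwap_single_of_lt {i j : ℕ} (h : i < j) :
    signedSwap i (Pi.single j 1) = Pi.single j 1 := by
  cases i with
  | zero =>
    ext l
    rcases eq_or_ne l 0 with rfl | hl <;> simp [signedSwap_zero_apply, h.ne, *]
  | succ i =>
    rw [signedSwap_succ_single, Equiv.swap_apply_of_ne_of_ne (by omega) (by omega)]

theorem rank_signedSwap_sub_one_le (i : ℕ) : (signedSwap i - 1).rank ≤ 1 := by
  refine (rank_submodule_le_one_iff' _).2 ?_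
  cases i with
  | zero =>
    refine ⟨Pi.single 0 1, ?_⟩
    rintro _ ⟨v, rfl⟩
    refine Submodule.mem_span_singleton.2 ⟨-2 * v 0, ?_⟩
    ext j
    rcases eq_or_ne j 0 with rfl | hj
    · simp [signedSwap_zero_apply]; ring
    · simp [signedSwap_zero_apply, hj]
  | succ i =>
    refine ⟨Pi.single i 1 - Pi.single (i + 1) 1, ?_⟩
    rintro _ ⟨v, rfl⟩
    refine Submodule.mem_span_singleton.2 ⟨v (i + 1) - v i, ?_⟩
    ext j
    rcases eq_or_ne j i with rfl | hj
    · simp [signedSwap_succ_apply]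
    rcases eq_or_ne j (i + 1) with rfl | hj'
    · simp [signedSwap_succ_apply]
    · simp [signedSwap_succ_apply, Equiv.swap_apply_of_ne_of_ne hj hj', hj, hj']

theorem signedSwap_mul_self (i : ℕ) : signedSwap i * signedSwap i = 1 := by
  refine LinearMap.ext fun v => funext fun j => ?_
  cases i with
  | zero =>
    rw [Module.End.mul_apply, signedSwap_zero_apply, signedSwap_zero_apply]
    split_ifs <;> simp
  | succ i => simp [signedSwap_succ_apply]

theorem signedSwap_comm {i j : ℕ} (h : i + 1 < j) :
    signedSwap i * signedSwap j = signedSwap j * signedSwap i := by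
  obtain ⟨j, rfl⟩ : ∃ l, j = l + 1 := ⟨j - 1, by omega⟩
  refine LinearMap.ext fun v => funext fun l => ?_
  cases i with
  | zero =>
    have : Equiv.swap j (j + 1) l = 0 ↔ l = 0 := by
      rw [Equiv.swap_apply_eq_iff, Equiv.swap_apply_of_ne_of_ne (by omega) (by omega)]
    simp only [Module.End.mul_apply, signedSwap_zero_apply, signedSwap_succ_apply, this]
  | succ i =>
    simp only [Module.End.mul_apply, signedSwap_succ_apply]
    congr 1
    simp only [Equiv.swap_apply_def]
    split_ifs <;> omega

theorem signedSwap_braid (i : ℕ) :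
    signedSwap (i + 1) * signedSwap (i + 2) * signedSwap (i + 1) =
      signedSwap (i + 2) * signedSwap (i + 1) * signedSwap (i + 2) := by
  refine LinearMap.ext fun v => funext fun l => ?_
  simp only [Module.End.mul_apply, signedSwap_succ_apply]
  congr 1
  simp only [Equiv.swap_apply_def]
  split_ifs <;> omega

theorem signedSwap_braid_zero :
    signedSwap 0 * signedSwap 1 * signedSwap 0 * signedSwap 1 =
      signedSwap 1 * signedSwap 0 * signedSwap 1 * signedSwap 0 := by
  refine LinearMap.ext fun v => funext fun l => ?_
  have h1 : ∀ v j, signedSwap 1 v j = v (Equiv.swap 0 1 j) := signedSwap_succ_apply 0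
  simp only [Module.End.mul_apply, signedSwap_zero_apply, h1]
  rcases eq_or_ne l 0 with rfl | h0
  · simp
  rcases eq_or_ne l 1 with rfl | h1
  · simp
  · simp [Equiv.swap_apply_of_ne_of_ne h0 h1, h0]

end SignedSwap

/-- A representation of `W` by signed permutations of coordinates, which realizes the generators
`r_i`. In type `A` the generator `r_0` is trivial. -/
structure IsSignedRepresentation {W : Type*} [Group W] (r : ℕ → W) (N : ℕ)
    (ρ : W →* Module.End ℚ (ℕ → ℚ)) : Prop where
  map_zero : r 0 = 1 ∨ ρ (r 0) = signedSwap 0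
  map_succ : ∀ i, i + 1 < N → ρ (r (i + 1)) = signedSwap (i + 1)

namespace IsSignedRepresentation

variable {W : Type*} [Group W] {r : ℕ → W} {N : ℕ} {ρ : W →* Module.End ℚ (ℕ → ℚ)}
  (hρ : IsSignedRepresentation r N ρ)
include hρ

theorem eq_one_or {i : ℕ} (hi : i < N) : r i = 1 ∨ ρ (r i) = signedSwap i := by
  cases i with
  | zero => exact hρ.map_zero
  | succ i => exact Or.inr (hρ.map_succ i hi)

theorem apply_of_mem_parabolic {k j : ℕ} (hk : k ≤ N) (hj : k ≤ j) {h : W}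
    (hh : h ∈ parabolic r k) (v : ℕ → ℚ) : ρ h v j = v j := by
  induction hh using Subgroup.closure_induction generalizing v with
  | mem x hx =>
    obtain ⟨i, hi, rfl⟩ := hx
    have hi' : i < k := hi
    rcases hρ.eq_one_or (show i < N by omega) with h | h
    · simp [h]
    · rw [h, signedSwap_apply_of_lt (by omega)]
  | one => simp
  | mul x y _ _ hx hy => rw [map_mul, Module.End.mul_apply, hx, hy]
  | inv x _ hx =>
    have : ρ x (ρ x⁻¹ v) = v := by
      rw [← Module.End.mul_apply, ← map_mul, mul_inv_cancel, map_one, Module.End.one_apply]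
    rw [← hx (ρ x⁻¹ v), this]

theorem apply_single_of_mem_parabolic {k j : ℕ} (hk : k ≤ N) (hj : k ≤ j) {h : W}
    (hh : h ∈ parabolic r k) : ρ h (Pi.single j 1) = Pi.single j 1 := by
  induction hh using Subgroup.closure_induction with
  | mem x hx =>
    obtain ⟨i, hi, rfl⟩ := hx
    have hi' : i < k := hi
    rcases hρ.eq_one_or (show i < N by omega) with h | h
    · simp [h]
    · rw [h, signedSwap_single_of_lt (by omega)]
  | one => simp
  | mul x y _ _ hx hy => rw [map_mul, Module.End.mul_apply, hy, hx]
  | inv x _ hx =>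
    nth_rw 1 [← hx]
    rw [← Module.End.mul_apply, ← map_mul, inv_mul_cancel, map_one, Module.End.one_apply]

theorem signElement_eq_one_or (hr : IsTypeB r N) {k : ℕ} (hk : k < N) : signElement r k = 1 ∨
    ρ (signElement r k) (Pi.single k 1) = -Pi.single k 1 := by
  induction k with
  | zero =>
    refine hρ.map_zero.imp id fun h => ?_
    rw [signElement, h, signedSwap_zero_single]
  | succ k ih =>
    refine (ih (by omega)).imp (fun h => ?_) fun h => ?_
    · rw [signElement, h, mul_one, hr.mul_self _ hk]
    · rw [signElement, map_mul, map_mul, Module.End.mul_apply, Module.End.mul_apply,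
        hρ.map_succ k hk, signedSwap_succ_single, Equiv.swap_apply_right, h, map_neg,
        signedSwap_succ_single, Equiv.swap_apply_left]

variable [DecidableEq W]

theorem conj_apply_single {k : ℕ} (hk : k + 1 < N) {e : W} (he : e ∈ cosetReps r k) :
    ρ (e * r (k + 1) * e⁻¹) (Pi.single (k + 1) 1) = ρ e (Pi.single k 1) := by
  have he' := cosetReps_subset_parabolic k e he
  rw [map_mul, map_mul, Module.End.mul_apply, Module.End.mul_apply,
    hρ.apply_single_of_mem_parabolic hk.le le_rfl (inv_mem he'), hρ.map_succ k hk,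
    signedSwap_succ_single, Equiv.swap_apply_right]

theorem apply_single_apply_succ {k : ℕ} (hk : k + 1 < N) {e : W} (he : e ∈ cosetReps r k) :
    ρ e (Pi.single k 1) (k + 1) = 0 := by
  rw [hρ.apply_of_mem_parabolic hk.le le_rfl (cosetReps_subset_parabolic k e he)]
  simp

/-- The three kinds of coset representatives, told apart by the last coordinate of the image of the
last basis vector. -/
theorem cosetReps_trichotomy (hr : IsTypeB r N) {k : ℕ} (hk : k < N) {c : W}
    (hc : c ∈ cosetReps r k) :
    (c = 1 ∧ ρ c (Pi.single k 1) k = 1) ∨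
    (c = signElement r k ∧ ρ c (Pi.single k 1) k = -1) ∨
    (ρ c (Pi.single k 1) k = 0 ∧ ∃ j, k = j + 1 ∧ ∃ e ∈ cosetReps r j, c = e * r k * e⁻¹ ∧
      ρ c (Pi.single k 1) = ρ e (Pi.single j 1)) := by
  rcases cosetReps_cases hc with rfl | rfl | ⟨j, rfl, e, he, rfl⟩
  · exact Or.inl (by simp)
  · rcases hρ.signElement_eq_one_or hr hk with h | h
    · exact Or.inl (by simp [h])
    · exact Or.inr (Or.inl (by simp [h]))
  · refine Or.inr (Or.inr ⟨?_, j, rfl, e, he, rfl, hρ.conj_apply_single hk he⟩)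
    rw [hρ.conj_apply_single hk he, hρ.apply_single_apply_succ hk he]

/-- A coset representative is determined by the image of the last basis vector. -/
theorem cosetReps_injOn (hr : IsTypeB r N) {k : ℕ} (hk : k < N) {c d : W}
    (hc : c ∈ cosetReps r k) (hd : d ∈ cosetReps r k)
    (h : ρ c (Pi.single k 1) = ρ d (Pi.single k 1)) : c = d := by
  induction k generalizing c d with
  | zero =>
    have h0 := congrFun h 0
    rcases hρ.cosetReps_trichotomy hr hk hc with ⟨h1, e1⟩ | ⟨h1, e1⟩ | ⟨-, j, hj, -⟩ <;>
      rcases hρ.cosetReps_trichotomy hr hk hd with ⟨h2, e2⟩ | ⟨h2, e2⟩ | ⟨-, j', hj', -⟩ <;>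
      first
      | omega
      | exact h1.trans h2.symm
      | (rw [e1, e2] at h0; norm_num at h0)
  | succ k ih =>
    have h0 := congrFun h (k + 1)
    rcases hρ.cosetReps_trichotomy hr hk hc with ⟨h1, e1⟩ | ⟨h1, e1⟩ | ⟨e1, j, hj, e, he, h1, f1⟩ <;>
      rcases hρ.cosetReps_trichotomy hr hk hd with
        ⟨h2, e2⟩ | ⟨h2, e2⟩ | ⟨e2, j', hj', e', he', h2, f2⟩
    case inr.inr.inr.inr =>
      obtain rfl : k = j := by omega
      obtain rfl : k = j' := by omega
      rw [f1, f2] at h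
      rw [h1, h2, ih (by omega) he he' h]
    all_goals first
      | exact h1.trans h2.symm
      | (rw [e1, e2] at h0; norm_num at h0)

/-- Left multiplication by a nontrivial coset representative `c` raises the rank of `ρ h - 1`: the
root of `c` involves the last coordinate, whereas the range of `ρ h - 1` does not. -/
theorem rank_sub_one_add_one_le (hr : IsTypeB r N) {k : ℕ} (hk : k < N) {c h : W}
    (hc : c ∈ cosetReps r k) (hc1 : c ≠ 1) (hrank : (ρ c - 1).rank ≤ 1)
    (hh : h ∈ parabolic r k) : (ρ h - 1).rank + 1 ≤ (ρ (c * h) - 1).rank := by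
  set β : ℕ → ℚ := (ρ c - 1) (Pi.single k 1) with hβ
  have hβk : β k ≠ 0 := by
    have : β k = ρ c (Pi.single k 1) k - 1 := by simp [hβ]
    rw [this]
    rcases hρ.cosetReps_trichotomy hr hk hc with ⟨h1, -⟩ | ⟨-, e⟩ | ⟨e, -⟩
    · exact absurd h1 hc1
    · rw [e]; norm_num
    · rw [e]; norm_num
  have hβ0 : β ≠ 0 := fun h => hβk (by rw [h]; rfl)
  have hspan : LinearMap.range (ρ c - 1) ≤ Submodule.span ℚ {β} := by
    obtain ⟨v, hv⟩ := (rank_submodule_le_one_iff' _).1 hrank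
    obtain ⟨a, ha⟩ := Submodule.mem_span_singleton.1 (hv ⟨Pi.single k 1, rfl⟩)
    rw [← hβ] at ha
    have ha0 : a ≠ 0 := by
      rintro rfl
      exact hβ0 (by rw [← ha, zero_smul])
    rwa [← ha, Submodule.span_singleton_smul_eq (IsUnit.mk0 a ha0)]
  have hβmem : β ∈ LinearMap.range (ρ (c * h) - 1) := by
    refine ⟨Pi.single k 1, ?_⟩
    rw [hβ, LinearMap.sub_apply, LinearMap.sub_apply, map_mul, Module.End.mul_apply,
      hρ.apply_single_of_mem_parabolic hk.le le_rfl hh]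
  have hβle : Submodule.span ℚ {β} ≤ LinearMap.range (ρ (c * h) - 1) :=
    (Submodule.span_singleton_le_iff_mem _ _).2 hβmem
  have hle : LinearMap.range (ρ h - 1) ≤ LinearMap.range (ρ (c * h) - 1) := by
    rintro _ ⟨v, rfl⟩
    have : (ρ h - 1) v = (ρ (c * h) - 1) v - (ρ c - 1) (ρ h v) := by
      simp [map_mul]
    rw [this]
    exact sub_mem ⟨v, rfl⟩ (hβle (hspan ⟨_, rfl⟩))
  have hdisj : LinearMap.range (ρ h - 1) ⊓ Submodule.span ℚ {β} = ⊥ := by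
    rw [Submodule.eq_bot_iff]
    rintro _ ⟨⟨v, rfl⟩, hv⟩
    obtain ⟨a, ha⟩ := Submodule.mem_span_singleton.1 hv
    have h0 : (ρ h - 1) v k = 0 := by
      simp [hρ.apply_of_mem_parabolic hk.le le_rfl hh]
    rw [← ha] at h0 ⊢
    have ha0 : a = 0 := (mul_eq_zero.1 h0).resolve_right hβk
    rw [ha0, zero_smul]
  have hdim := Submodule.rank_sup_add_rank_inf_eq (LinearMap.range (ρ h - 1))
    (Submodule.span ℚ {β})
  rw [hdisj, rank_bot, add_zero, ← Module.finrank_eq_rank ℚ (Submodule.span ℚ {β}),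
    finrank_span_singleton hβ0, Nat.cast_one] at hdim
  rw [LinearMap.rank, ← hdim]
  exact Submodule.rank_mono (sup_le hle hβle)

end IsSignedRepresentation

/-! ### Coxeter groups of signed permutations are strong Sperner -/

section StrongSperner

variable {B W : Type*} [Group W] {M : CoxeterMatrix B} {cs : CoxeterSystem M W}
  {r : ℕ → W} {N : ℕ} {ρ : W →* Module.End ℚ (ℕ → ℚ)}

theorem signElement_eq_one_or_isReflection (hr : IsTypeB r N)
    (hrefl : ∀ i < N, r i = 1 ∨ cs.IsReflection (r i)) {k : ℕ} (hk : k < N) :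
    signElement r k = 1 ∨ cs.IsReflection (signElement r k) := by
  induction k with
  | zero => exact hrefl 0 hk
  | succ k ih =>
    refine (ih (by omega)).imp (fun h => ?_) fun h => ?_
    · rw [signElement, h, mul_one, hr.mul_self _ hk]
    · have := h.conj (r (k + 1))
      rwa [hr.inv_eq hk] at this

theorem cosetReps_eq_one_or_isReflection [DecidableEq W] (hr : IsTypeB r N)
    (hrefl : ∀ i < N, r i = 1 ∨ cs.IsReflection (r i)) {k : ℕ} (hk : k < N) {c : W}
    (hc : c ∈ cosetReps r k) : c = 1 ∨ cs.IsReflection c := by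
  rcases cosetReps_cases hc with rfl | rfl | ⟨j, rfl, e, -, rfl⟩
  · exact Or.inl rfl
  · exact signElement_eq_one_or_isReflection hr hrefl hk
  · refine (hrefl _ hk).imp (fun h => ?_) fun h => h.conj e
    rw [h, mul_one, mul_inv_cancel]

/-- On `⟨r_i : i < k⟩` the absolute length is the rank of `ρ w - 1`, and the absolute order is
normalized and log-concave there: each step from `k` to `k + 1` is a product with a claw. -/
theorem cosetProducts_isNormalizedLogConcave [DecidableEq W] (hr : IsTypeB r N)
    (hρ : IsSignedRepresentation r N ρ) (hgen : ∀ i : B, ∃ k < N, cs.simple i = r k)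
    (hrefl : ∀ i < N, r i = 1 ∨ cs.IsReflection (r i)) {k : ℕ} (hk : k ≤ N) :
    (∀ w ∈ cosetProducts r k, (ρ w - 1).rank = (absLength cs w : Cardinal)) ∧
    IsNormalizedLogConcave
      (fun x y => absLength cs y = absLength cs x + absLength cs (x⁻¹ * y))
      (absLength cs) (cosetProducts r k) := by
  have hupper : ∀ w, (ρ w - 1).rank ≤ (absLength cs w : Cardinal) := by
    refine rank_sub_one_le_absLength cs ρ fun i => ?_
    obtain ⟨k, hk, hik⟩ := hgen i
    rw [hik]
    rcases hρ.eq_one_or hk with h | h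
    · simp [h]
    · rw [h]
      exact rank_signedSwap_sub_one_le k
  induction k with
  | zero =>
    refine ⟨fun w hw => ?_, .singleton _ (absLength_one cs)⟩
    rw [cosetProducts, Finset.mem_singleton] at hw
    simp [hw, absLength_one]
  | succ k ih =>
    obtain ⟨ihrank, ihnorm⟩ := ih (by omega)
    have hrefl' : ∀ c ∈ (cosetReps r k).erase 1, cs.IsReflection c := fun c hc =>
      (cosetReps_eq_one_or_isReflection hr hrefl hk (Finset.mem_of_mem_erase hc)).resolve_left
        (Finset.ne_of_mem_erase hc)
    have hlow : ∀ c ∈ (cosetReps r k).erase 1, ∀ h ∈ cosetProducts r k,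
        ((absLength cs h + 1 : ℕ) : Cardinal) ≤ (ρ (c * h) - 1).rank := by
      intro c hc h hh
      have h1 : (ρ c - 1).rank ≤ 1 := (hupper c).trans
        (by exact_mod_cast absLength_le_one cs (hrefl' c hc))
      have := hρ.rank_sub_one_add_one_le hr hk (Finset.mem_of_mem_erase hc)
        (Finset.ne_of_mem_erase hc) h1 (cosetProducts_subset_parabolic k h hh)
      rw [ihrank h hh] at this
      exact_mod_cast this
    have hlen : ∀ c ∈ (cosetReps r k).erase 1, ∀ h ∈ cosetProducts r k,
        absLength cs (c * h) = absLength cs h + 1 := fun c hc h hh =>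
      le_antisymm (absLength_mul_le_add_one cs (hrefl' c hc) h)
        (by exact_mod_cast (hlow c hc h hh).trans (hupper _))
    have hsub : cosetProducts r k ⊆ cosetProducts r (k + 1) := fun h hh =>
      Finset.mem_mul.2 ⟨1, one_mem_cosetReps k, h, hh, one_mul h⟩
    refine ⟨fun w hw => ?_, ihnorm.claw ((cosetReps r k).erase 1) (fun c h => c * h) (fun F => ?_)
      hsub (fun c hc h hh => Finset.mul_mem_mul (Finset.mem_of_mem_erase hc) hh) hlen
      (fun c hc h hh => absLength_mul_eq_of_isReflection cs (hrefl' c hc) (hlen c hc h hh))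
      (fun c hc x hx y hy hxy => ?_)⟩
    · obtain ⟨c, hc, h, hh, rfl⟩ := Finset.mem_mul.1 hw
      by_cases hc1 : c = 1
      · rw [hc1, one_mul, ihrank h hh]
      · have hc' := Finset.mem_erase.2 ⟨hc1, hc⟩
        refine le_antisymm (hupper _) ?_
        rw [hlen c hc' h hh]
        exact hlow c hc' h hh
    · have hinj : Set.InjOn (fun p : W × W => p.1 * p.2)
          (cosetReps r k ×ˢ cosetProducts r k : Finset (W × W)) := by
        rintro ⟨c, h⟩ hp ⟨d, g⟩ hq heq
        obtain ⟨hc, hh⟩ := Finset.mem_product.1 (Finset.mem_coe.1 hp)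
        obtain ⟨hd, hg⟩ := Finset.mem_product.1 (Finset.mem_coe.1 hq)
        have heq' : c * h = d * g := heq
        have hcd : c = d := by
          refine hρ.cosetReps_injOn hr hk hc hd ?_
          have h1 := congrArg (fun w => ρ w (Pi.single k 1)) heq'
          simpa only [map_mul, Module.End.mul_apply,
            hρ.apply_single_of_mem_parabolic (Nat.le_of_succ_le hk) le_rfl
              (cosetProducts_subset_parabolic k _ hh),
            hρ.apply_single_of_mem_parabolic (Nat.le_of_succ_le hk) le_rfl
              (cosetProducts_subset_parabolic k _ hg)] using h1
        subst hcd
        rw [mul_left_cancel heq']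
      rw [cosetProducts, ← Finset.image_mul_product, Finset.sum_image hinj, Finset.sum_product,
        ← Finset.add_sum_erase _ _ (one_mem_cosetReps k)]
      simp
    · rw [hlen c hc x hx, hlen c hc y hy, hxy, mul_inv_rev, mul_assoc, inv_mul_cancel_left]
      omega

theorem isStrongSperner_of_isSignedRepresentation (hr : IsTypeB r N)
    (hρ : IsSignedRepresentation r N ρ) (hgen : ∀ i : B, ∃ k < N, cs.simple i = r k)
    (hrefl : ∀ i < N, r i = 1 ∨ cs.IsReflection (r i)) :
    IsStrongSperner (AbsoluteOrder cs) := by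
  classical
  have huniv : ∀ w : W, w ∈ cosetProducts r N := by
    intro w
    refine hr.mem_cosetProducts le_rfl ?_
    induction w using cs.simple_induction with
    | simple i =>
      obtain ⟨k, hk, hik⟩ := hgen i
      exact hik ▸ mem_parabolic hk
    | one => exact one_mem _
    | mul x y hx hy => exact mul_mem hx hy
  let _ : Fintype (AbsoluteOrder cs) := ⟨(cosetProducts r N : Finset W), huniv⟩
  have : Nonempty (AbsoluteOrder cs) := ⟨AbsoluteOrder.of cs 1⟩
  exact isStrongSperner_of_isNormalizedLogConcave
    (cosetProducts_isNormalizedLogConcave hr hρ hgen hrefl le_rfl).2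

end StrongSperner

/-! ### Types `A` and `B` -/

section Types

theorem mul_pow_three_eq_one {G : Type*} [Monoid G] {a b : G} (ha : a * a = 1) (hb : b * b = 1)
    (h : a * b * a = b * a * b) : (a * b) ^ 3 = 1 := by
  have : (a * b) ^ 3 = (a * b * a) * (b * a * b) := by
    simp only [pow_succ, pow_zero, one_mul, mul_assoc]
  rw [this, h]
  calc b * a * b * (b * a * b) = b * (a * (b * b) * a) * b := by simp only [mul_assoc]
    _ = 1 := by rw [hb, mul_one, ha, mul_one, hb]

theorem mul_pow_two_eq_one {G : Type*} [Monoid G] {a b : G} (ha : a * a = 1) (hb : b * b = 1)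
    (h : a * b = b * a) : (a * b) ^ 2 = 1 := by
  rw [pow_two]
  nth_rw 1 [h]
  rw [mul_assoc, ← mul_assoc a, ha, one_mul, hb]

theorem mul_pow_four_eq_one {G : Type*} [Monoid G] {a b : G} (ha : a * a = 1) (hb : b * b = 1)
    (h : a * b * a * b = b * a * b * a) : (a * b) ^ 4 = 1 := by
  have : (a * b) ^ 4 = (a * b * a * b) * (a * b * a * b) := by
    simp only [pow_succ, pow_zero, one_mul, mul_assoc]
  rw [this]
  nth_rw 1 [h]
  calc b * a * b * a * (a * b * a * b) = b * (a * (b * (a * a) * b) * a) * b := by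
        simp only [mul_assoc]
    _ = 1 := by rw [ha, mul_one, hb, mul_one, ha, mul_one, hb]

variable {B W : Type*} [Group W] {M : CoxeterMatrix B} (cs : CoxeterSystem M W)

theorem simple_comm {i j : B} (h : M i j = 2) :
    cs.simple i * cs.simple j = cs.simple j * cs.simple i := by
  have hp := cs.simple_mul_simple_pow i j
  rw [h, pow_two] at hp
  simpa using eq_inv_of_mul_eq_one_left hp

theorem simple_braid {i j : B} (h : M i j = 3) :
    cs.simple i * cs.simple j * cs.simple i = cs.simple j * cs.simple i * cs.simple j := by
  have hp := cs.simple_mul_simple_pow i j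
  have : (cs.simple i * cs.simple j) ^ 3 =
      (cs.simple i * cs.simple j * cs.simple i) * (cs.simple j * cs.simple i * cs.simple j) := by
    simp only [pow_succ, pow_zero, one_mul, mul_assoc]
  rw [h, this] at hp
  simpa [mul_assoc] using eq_inv_of_mul_eq_one_left hp

theorem simple_braid_four {i j : B} (h : M i j = 4) :
    cs.simple i * cs.simple j * cs.simple i * cs.simple j =
      cs.simple j * cs.simple i * cs.simple j * cs.simple i := by
  have hp := cs.simple_mul_simple_pow i j
  have : (cs.simple i * cs.simple j) ^ 4 =
      (cs.simple i * cs.simple j * cs.simple i * cs.simple j) *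
        (cs.simple i * cs.simple j * cs.simple i * cs.simple j) := by
    simp only [pow_succ, pow_zero, one_mul, mul_assoc]
  rw [h, this] at hp
  simpa [mul_assoc] using eq_inv_of_mul_eq_one_left hp

theorem coxeterMatrix_A_apply {n : ℕ} (i j : Fin n) : CoxeterMatrix.A n i j =
    if i = j then 1 else if (j : ℕ) + 1 = i ∨ (i : ℕ) + 1 = j then 3 else 2 := rfl

theorem coxeterMatrix_B_apply {n : ℕ} (i j : Fin n) : CoxeterMatrix.B n i j =
    if i = j then 1
      else if (i : ℕ) = n - 1 ∧ (j : ℕ) = n - 2 ∨ (j : ℕ) = n - 1 ∧ (i : ℕ) = n - 2 then 4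
        else if (j : ℕ) + 1 = i ∨ (i : ℕ) + 1 = j then 3 else 2 := rfl

theorem signedSwap_comm_of_ne {i j : ℕ} (h : i + 1 < j ∨ j + 1 < i) :
    signedSwap i * signedSwap j = signedSwap j * signedSwap i :=
  h.elim signedSwap_comm fun h => (signedSwap_comm h).symm

theorem isLiftable_A (n : ℕ) :
    (CoxeterMatrix.A n).IsLiftable fun i : Fin n => signedSwap (i + 1) := by
  intro i j
  rw [coxeterMatrix_A_apply]
  split_ifs with h1 h2
  · rw [h1, pow_one, signedSwap_mul_self]
  · refine mul_pow_three_eq_one (signedSwap_mul_self _) (signedSwap_mul_self _) ?_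
    beta_reduce
    rcases h2 with h2 | h2
    · rw [← h2]
      exact (signedSwap_braid _).symm
    · rw [← h2]
      exact signedSwap_braid _
  · have h1' : (i : ℕ) ≠ j := fun h => h1 (Fin.ext h)
    exact mul_pow_two_eq_one (signedSwap_mul_self _) (signedSwap_mul_self _)
      (signedSwap_comm_of_ne (by omega))

/-- In the diagram `CoxeterMatrix.B n` the double bond joins the last two nodes, so that the node
`i` acts by the generator `n - 1 - i`. -/
theorem isLiftable_B (n : ℕ) :
    (CoxeterMatrix.B n).IsLiftable fun i : Fin n => signedSwap (n - 1 - i) := by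
  intro i j
  have hi := i.isLt
  have hj := j.isLt
  rw [coxeterMatrix_B_apply]
  split_ifs with h1 h2 h3
  · rw [h1, pow_one, signedSwap_mul_self]
  · have h1' : (i : ℕ) ≠ j := fun h => h1 (Fin.ext h)
    refine mul_pow_four_eq_one (signedSwap_mul_self _) (signedSwap_mul_self _) ?_
    beta_reduce
    rcases h2 with h2 | h2
    · rw [show n - 1 - (i : ℕ) = 0 by omega, show n - 1 - (j : ℕ) = 1 by omega]
      exact signedSwap_braid_zero
    · rw [show n - 1 - (i : ℕ) = 1 by omega, show n - 1 - (j : ℕ) = 0 by omega]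
      exact signedSwap_braid_zero.symm
  · refine mul_pow_three_eq_one (signedSwap_mul_self _) (signedSwap_mul_self _) ?_
    beta_reduce
    rcases h3 with h3 | h3
    · obtain ⟨l, hl⟩ : ∃ l, n - 1 - (i : ℕ) = l + 1 := ⟨n - 1 - i - 1, by omega⟩
      rw [hl, show n - 1 - (j : ℕ) = l + 2 by omega]
      exact signedSwap_braid l
    · obtain ⟨l, hl⟩ : ∃ l, n - 1 - (j : ℕ) = l + 1 := ⟨n - 1 - j - 1, by omega⟩
      rw [hl, show n - 1 - (i : ℕ) = l + 2 by omega]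
      exact (signedSwap_braid l).symm
  · have h1' : (i : ℕ) ≠ j := fun h => h1 (Fin.ext h)
    exact mul_pow_two_eq_one (signedSwap_mul_self _) (signedSwap_mul_self _)
      (signedSwap_comm_of_ne (by omega))

theorem isStrongSperner_A {n : ℕ} {W : Type*} [Group W]
    (cs : CoxeterSystem (CoxeterMatrix.A n) W) : IsStrongSperner (AbsoluteOrder cs) := by
  -- The trivial element takes the place of the sign change.
  let r : ℕ → W := fun k => if h : 0 < k ∧ k < n + 1 then cs.simple ⟨k - 1, by omega⟩ else 1
  have hr0 : r 0 = 1 := dif_neg (by omega)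
  have hrs : ∀ k (h : k < n), r (k + 1) = cs.simple ⟨k, h⟩ := fun k h => dif_pos (by omega)
  refine isStrongSperner_of_isSignedRepresentation (r := r) (N := n + 1)
    (ρ := cs.lift ⟨_, isLiftable_A n⟩) ⟨?_, ?_, ?_, ?_⟩ ⟨Or.inl hr0, ?_⟩ ?_ ?_
  · rintro (_ | i) hi
    · rw [hr0, one_mul]
    · rw [hrs i (by omega), cs.simple_mul_simple_self]
  · rintro (_ | i) (_ | j) hij hj
    · omega
    · rw [hr0, one_mul, mul_one]
    · omega
    · rw [hrs i (by omega), hrs j (by omega)]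
      refine simple_comm cs ?_
      rw [coxeterMatrix_A_apply, if_neg (by simp; omega), if_neg (by simp; omega)]
  · rintro (_ | i) hi hiN
    · omega
    · rw [hrs i (by omega), hrs (i + 1) (by omega)]
      refine simple_braid cs ?_
      rw [coxeterMatrix_A_apply, if_neg (by simp), if_pos (by simp)]
  · intro hn
    rw [hr0, one_mul, mul_one, mul_one, hrs 0 (by omega)]
  · intro i hi
    rw [hrs i (by omega), cs.lift_apply_simple]
  · exact fun i => ⟨i + 1, by omega, (hrs i i.isLt).symm⟩
  · rintro (_ | i) hi
    · exact Or.inl hr0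
    · exact Or.inr (hrs i (by omega) ▸ cs.isReflection_simple _)

theorem isStrongSperner_B {n : ℕ} {W : Type*} [Group W]
    (cs : CoxeterSystem (CoxeterMatrix.B n) W) : IsStrongSperner (AbsoluteOrder cs) := by
  let r : ℕ → W := fun k => if h : k < n then cs.simple ⟨n - 1 - k, by omega⟩ else 1
  have hrs : ∀ k (h : k < n), r k = cs.simple ⟨n - 1 - k, by omega⟩ := fun k h => dif_pos h
  have hmap : ∀ k < n, cs.lift ⟨_, isLiftable_B n⟩ (r k) = signedSwap k := by
    intro k hk
    rw [hrs k hk, cs.lift_apply_simple]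
    congr 1
    simp only
    omega
  refine isStrongSperner_of_isSignedRepresentation (r := r) (N := n)
    (ρ := cs.lift ⟨_, isLiftable_B n⟩) ⟨?_, ?_, ?_, ?_⟩ ⟨?_, ?_⟩ ?_ ?_
  · intro i hi
    rw [hrs i hi, cs.simple_mul_simple_self]
  · intro i j hij hj
    rw [hrs i (by omega), hrs j hj]
    refine simple_comm cs ?_
    rw [coxeterMatrix_B_apply, if_neg (by simp; omega), if_neg (by simp; omega),
      if_neg (by simp; omega)]
  · intro i hi hiN
    rw [hrs i (by omega), hrs (i + 1) hiN]
    refine simple_braid cs ?_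
    rw [coxeterMatrix_B_apply, if_neg (by simp; omega), if_neg (by simp; omega),
      if_pos (by simp; omega)]
  · intro hn
    rw [hrs 0 (by omega), hrs 1 hn]
    refine simple_braid_four cs ?_
    rw [coxeterMatrix_B_apply, if_neg (by simp; omega), if_pos (by simp; omega)]
  · by_cases hn : 0 < n
    · exact Or.inr (hmap 0 hn)
    · exact Or.inl (dif_neg hn)
  · exact fun i hi => hmap (i + 1) hi
  · intro i
    have hi := i.isLt
    refine ⟨n - 1 - i, by omega, ?_⟩
    rw [hrs _ (by omega)]
    congr 1
    ext
    simp only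
    omega
  · exact fun i hi => Or.inr (hrs i hi ▸ cs.isReflection_simple _)

end Types

/-- The absolute order on the Coxeter groups of types `A_n` and `B_n` is strong Sperner. -/
theorem theorem6p1 (n : ℕ) :
    (∀ {W : Type*} [Group W] (cs : CoxeterSystem (CoxeterMatrix.A n) W),
      IsStrongSperner (AbsoluteOrder cs)) ∧
    (∀ {W : Type*} [Group W] (cs : CoxeterSystem (CoxeterMatrix.B n) W),
      IsStrongSperner (AbsoluteOrder cs)) :=
  ⟨fun cs => isStrongSperner_A cs, fun cs => isStrongSperner_B cs⟩
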